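/- Fix integers $d \ge 1$, $k \ge 0$ and a noise level $\sigma > 0$, and put $s = (k+1)/d$. For $N \ge 1$ let $n = N^d$ and consider the $d$-dimensional grid graph with vertex set $\{1,\dots,N\}^d$, in which two vertices are joined by an edge if they differ by $1$ in exactly one coordinate and agree in all the others. Let $D$ be its oriented edge-vertex incidence matrix, so that $|(Dx)_e| = |x_u - x_v|$ for each edge $e = \{u,v\}$ and each $x \in \mathbb{R}^n$, let $L = D^{\mathsf T} D$ be the graph Laplacian, and let $S^{(2q)}_{n,d} = L^q$ and $S^{(2q+1)}_{n,d} = D L^q$ be the graph trend filtering operators. For each $n$ of this form let $\theta_0 = \theta_0^{(n)} \in \mathbb{R}^n$, let $y_i \sim N(\theta_{0,i}, \sigma^2)$ independently for $i = 1,\dots,n$, and put $C_n = \| S^{(k+1)}_{n,d} \theta_0 \|_1$; in the case $s > 1/2$ assume that $C_n > 0$ for all large $n$. Let $\hat\theta$ be the graph trend filtering estimator, that is, the minimizer over $\theta \in \mathbb{R}^n$ of $$ \tfrac12 \| y - \theta \|_2^2 + \lambda \| S^{(k+1)}_{n,d} \theta \|_1 . $$ Set $$ \varphi_n = \begin{cases}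 \sqrt{\log n} & \text{if } s < 1/2, \\ \log n & \text{if } s = 1/2, \\ (\log n)^{\frac{1}{2s+1}} (n/C_n)^{\frac{2s-1}{2s+1}} & \text{if } s > 1/2. \end{cases} $$ Then there is a constant $A > 0$ depending only on $k, d, \sigma$ such that, for every sequence $\theta_0^{(n)}$ as above and every choice of $\lambda = \lambda_n \asymp \varphi_n$ with $A \varphi_n \le \lambda_n \le B \varphi_n$ for all large $n$ (where $B$ is any constant), as $n \to \infty$ with $k, d, \sigma$ fixed, $$ \frac1n \| \hat\theta - \theta_0 \|_2^2 = O_{\mathbb P}\Big( \frac1n + \frac{\lambda}{n} C_n \Big), $$ that is, for every $\delta > 0$ there is an $M$ such that for all large $n$ the left-hand side exceeds $M\,( 1/n + \lambda C_n / n )$ with probability at most $\delta$. -/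

import Mathlib

open MeasureTheory ProbabilityTheory Filter Topology
open scoped Matrix

noncomputable section

namespace GridGTF

/-- Vertices of the `d`-dimensional grid with side length `N` (there are `n = N ^ d` of them). -/
abbrev Grid (d N : ℕ) : Type := Fin d → Fin N

/-- Edges of the grid: a direction `j` and a vertex `x` whose `j`-th coordinate can be increased
by one; the edge joins `x` to `x + e_j`. -/
abbrev Edge (d N : ℕ) : Type := {e : Fin d × Grid d N // (e.2 e.1 : ℕ) + 1 < N}

/-- The endpoint `x` of the edge from `x` to `x + e_j`. -/
def Edge.tail {d N : ℕ} (e : Edge d N) : Grid d N := e.1.2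

/-- The endpoint `x + e_j` of the edge from `x` to `x + e_j`. -/
def Edge.head {d N : ℕ} (e : Edge d N) : Grid d N :=
  Function.update e.1.2 e.1.1 ⟨(e.1.2 e.1.1 : ℕ) + 1, e.2⟩

/-- The (oriented) edge-vertex incidence matrix of the grid graph:
`(D x)_e = x_{head e} - x_{tail e}`. -/
def incidence (d N : ℕ) : Matrix (Edge d N) (Grid d N) ℝ :=
  fun e v => (if v = e.head then 1 else 0) - (if v = e.tail then 1 else 0)

/-- The graph Laplacian `L = Dᵀ D`. -/
def laplacian (d N : ℕ) : Matrix (Grid d N) (Grid d N) ℝ :=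
  (incidence d N)ᵀ * incidence d N

/-- The `ℓ¹` norm of a finite real vector. -/
def l1Norm {ι : Type*} [Fintype ι] (x : ι → ℝ) : ℝ := ∑ i, |x i|

/-- `‖S^{(m)} θ‖₁` for the order `m` graph trend filtering operator of the grid,
where `S^{(2q)} = L ^ q` and `S^{(2q+1)} = D L ^ q`. -/
def gtfPenalty (d N m : ℕ) (θ : Grid d N → ℝ) : ℝ :=
  if Even m then l1Norm ((laplacian d N ^ (m / 2)) *ᵥ θ)
  else l1Norm ((incidence d N * laplacian d N ^ (m / 2)) *ᵥ θ)

/-- The criterion `½ ‖y - θ‖₂² + λ ‖S^{(k+1)} θ‖₁` of `k`-th order graph trend filtering. -/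
def gtfObjective (d N k : ℕ) (lam : ℝ) (y θ : Grid d N → ℝ) : ℝ :=
  1 / 2 * ∑ i, (y i - θ i) ^ 2 + lam * gtfPenalty d N (k + 1) θ

/-- `θ` solves the `k`-th order graph trend filtering problem with data `y` and tuning
parameter `lam`. -/
def IsGTF (d N k : ℕ) (lam : ℝ) (y θ : Grid d N → ℝ) : Prop :=
  ∀ θ' : Grid d N → ℝ, gtfObjective d N k lam y θ ≤ gtfObjective d N k lam y θ'

/-- The mean squared error `(1/n) ‖θ - θ₀‖₂²`, with `n = N ^ d`. -/
def mse {d N : ℕ} (θ θ₀ : Grid d N → ℝ) : ℝ :=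
  1 / (N : ℝ) ^ d * ∑ i, (θ i - θ₀ i) ^ 2

/-- The effective degree of smoothness `s = (k + 1) / d`. -/
def smoothness (d k : ℕ) : ℝ := ((k : ℝ) + 1) / (d : ℝ)

/-- The prescribed order of magnitude of the tuning parameter, as a function of the effective
smoothness `s`, the sample size `n`, and `C = ‖S^{(k+1)} θ₀‖₁`. -/
def lamRate (s n C : ℝ) : ℝ :=
  if s < 1 / 2 then √(Real.log n)
  else if s = 1 / 2 then Real.log n
  else Real.log n ^ (1 / (2 * s + 1)) * (n / C) ^ ((2 * s - 1) / (2 * s + 1))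

/-- `X_N = O_ℙ(b_N)` for random variables `X_N` (each on its own probability space) and
deterministic `b_N`. -/
def IsBigOInProb {Ω : ℕ → Type*} [∀ N, MeasurableSpace (Ω N)] (P : ∀ N, Measure (Ω N))
    (X : ∀ N, Ω N → ℝ) (b : ℕ → ℝ) : Prop :=
  ∀ δ : ℝ, 0 < δ → ∃ M : ℝ, ∀ᶠ N in atTop,
    P N {ω | M * |b N| < |X N ω|} ≤ ENNReal.ofReal δ

end GridGTF

end

/-! Comparing the criterion at `θhat` and `θ₀` gives, with Δ = θhat - θ₀ and noise ε, ½‖Δ‖² ≤ ⟨ε, Δ⟩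
+ λ‖Sθ₀‖₁ - λ‖Sθhat‖₁. The tensor cosine basis u_i diagonalises L with eigenvalues μ_i, so ε can be
split at a frequency cutoff R.

On the cube of at most R^d low frequencies, Young's inequality costs the noise energy there, of mean
at most σ²R^d. The high-frequency noise has the form Sᵀg; if |g_e| ≤ λ for every e, it contributes
at most λ(‖Sθhat‖₁ + ‖Sθ₀‖₁), and the term in θhat cancels (`sum_sq_sub_le_of_isMinimizer`).

Each g_e is Gaussian. Since u_i and Du_i are spread evenly over the grid, its variance is at most
σ²W with W ≈ n⁻¹ ∑ μ_i^{-(k+1)} over high frequencies, and a union bound needs λ² ≥ 4σ²W log n. As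
μ_i ≳ (r/N)² on the shell at radius r, W is of order 1, log n or (N/R)^{2(k+1)-d} according to
whether s < 1/2, s = 1/2 or s > 1/2. In the first two cases R = 1 suffices; in the third R^d ≈ φ_n
C_n makes the low-frequency cost comparable to λC_n, and solving for λ yields φ_n (`exists_cutoff`).
-/

noncomputable section

namespace GridGTF

/-! ### Gaussian linear forms: tails and second moments. -/

section Gaussian

variable {Ω : Type*} [MeasurableSpace Ω] {P : Measure Ω}

lemma hasSubgaussianMGF_of_hasLaw_gaussianReal {X : Ω → ℝ} {s : NNReal}
    (hX : HasLaw X (gaussianReal 0 s) P) : HasSubgaussianMGF X s P where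
  integrable_exp_mul t := by
    have h := integrable_exp_mul_gaussianReal (μ := 0) (v := s) t
    rw [← hX.map_eq] at h
    exact h.comp_aemeasurable hX.aemeasurable
  mgf_le t := by
    rw [mgf_gaussianReal hX.map_eq]
    simp

lemma _root_.ProbabilityTheory.HasSubgaussianMGF.mono {X : Ω → ℝ} {c c' : NNReal}
    (h : HasSubgaussianMGF X c P) (hc : c ≤ c') : HasSubgaussianMGF X c' P where
  integrable_exp_mul := h.integrable_exp_mul
  mgf_le t := (h.mgf_le t).trans (by
    have : (c : ℝ) ≤ c' := hc
    gcongr)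

variable {V : Type*} [Fintype V] {ε : V → Ω → ℝ} {s : NNReal}

lemma measure_abs_linearCombination_gt_le [IsProbabilityMeasure P]
    (hlaw : ∀ v, HasLaw (ε v) (gaussianReal 0 s) P) (hind : iIndepFun ε P)
    (a : V → ℝ) {W l : ℝ} (hW : ∑ v, a v ^ 2 ≤ W) (hl : 0 ≤ l) :
    P.real {ω | l < |∑ v, a v * ε v ω|} ≤ 2 * Real.exp (-l ^ 2 / (2 * (s * W))) := by
  have hW0 : 0 ≤ W := (Finset.sum_nonneg fun v _ => sq_nonneg (a v)).trans hW
  have h1 : HasSubgaussianMGF (fun ω => ∑ v, a v * ε v ω)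
      (∑ v, NNReal.mk (a v ^ 2) (sq_nonneg _) * s) P := by
    refine HasSubgaussianMGF.sum_of_iIndepFun (X := fun v ω => a v * ε v ω) ?_
      (fun v _ => (hasSubgaussianMGF_of_hasLaw_gaussianReal (hlaw v)).const_mul (a v))
    exact hind.comp (fun v x => a v * x) (fun v => measurable_const_mul _)
  have h2 : HasSubgaussianMGF (fun ω => ∑ v, a v * ε v ω) (s * NNReal.mk W hW0) P := by
    refine h1.mono ?_
    rw [← Finset.sum_mul, mul_comm]
    gcongr
    rw [← NNReal.coe_le_coe]
    push_cast
    exact hW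
  have hp := h2.measure_ge_le hl
  have hn := h2.neg.measure_ge_le hl
  have hsub : {ω | l < |∑ v, a v * ε v ω|} ⊆
      {ω | l ≤ ∑ v, a v * ε v ω} ∪ {ω | l ≤ (-fun ω => ∑ v, a v * ε v ω) ω} := by
    intro ω hω
    rcases lt_abs.1 (show l < |∑ v, a v * ε v ω| from hω) with h | h
    · exact Or.inl h.le
    · exact Or.inr h.le
  calc _ ≤ _ := measureReal_mono hsub
    _ ≤ _ := measureReal_union_le _ _
    _ ≤ _ := add_le_add hp hn
    _ = _ := by push_cast; ring_nf

lemma integral_sq_linearCombination [IsProbabilityMeasure P]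
    (hlaw : ∀ v, HasLaw (ε v) (gaussianReal 0 s) P) (hind : iIndepFun ε P) (a : V → ℝ) :
    Integrable (fun ω => (∑ v, a v * ε v ω) ^ 2) P ∧
      ∫ ω, (∑ v, a v * ε v ω) ^ 2 ∂P = s * ∑ v, a v ^ 2 := by
  have hsg := fun v => hasSubgaussianMGF_of_hasLaw_gaussianReal (hlaw v)
  have hm : ∀ v, MemLp (fun ω => a v * ε v ω) 2 P := fun v => ((hsg v).memLp 2).const_mul _
  have hmS : MemLp (fun ω => ∑ v, a v * ε v ω) 2 P := memLp_finsetSum _ fun v _ => hm v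
  refine ⟨hmS.integrable_sq, ?_⟩
  have h0 : ∀ v, ∫ ω, ε v ω ∂P = 0 := fun v => by
    rw [(hlaw v).integral_eq]; exact integral_id_gaussianReal
  have hmean : ∫ ω, ∑ v, a v * ε v ω ∂P = 0 := by
    rw [integral_finsetSum _ fun v _ => (hm v).integrable (by norm_num)]
    simp [integral_const_mul, h0]
  have hvar : Var[fun ω => ∑ v, a v * ε v ω; P] = s * ∑ v, a v ^ 2 := by
    have := IndepFun.variance_sum (μ := P) (X := fun v ω => a v * ε v ω) (s := Finset.univ)
      (fun v _ => hm v) (fun v _ w _ hvw =>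
        (hind.indepFun hvw).comp (measurable_const_mul (a v)) (measurable_const_mul (a w)))
    have e : (∑ v, fun ω => a v * ε v ω) = fun ω => ∑ v, a v * ε v ω := by
      ext ω; simp
    rw [e] at this
    rw [this, Finset.mul_sum]
    refine Finset.sum_congr rfl fun v _ => ?_
    rw [variance_const_mul, (hlaw v).variance_eq, variance_id_gaussianReal, mul_comm]
  rw [← hvar, variance_eq_integral hmS.aemeasurable, hmean]
  simp

/-- Markov's inequality: each unit linear form has second moment `s`. A 1/t tail is enough, since
the constant in an O_ℙ bound may depend on δ. -/
lemma measure_sum_sq_linearCombination_gt_le [IsProbabilityMeasure P] {ι : Type*}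
    (hlaw : ∀ v, HasLaw (ε v) (gaussianReal 0 s) P) (hind : iIndepFun ε P)
    (I : Finset ι) (u : ι → V → ℝ) (hu : ∀ i ∈ I, ∑ v, u i v ^ 2 = 1) {t : ℝ} (ht : 0 < t) :
    P.real {ω | t < ∑ i ∈ I, (∑ v, u i v * ε v ω) ^ 2} ≤ s * I.card / t := by
  have hint : Integrable (fun ω => ∑ i ∈ I, (∑ v, u i v * ε v ω) ^ 2) P :=
    integrable_finsetSum _ fun i _ => (integral_sq_linearCombination hlaw hind (u i)).1
  have h := mul_meas_ge_le_integral_of_nonneg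
    (Eventually.of_forall fun ω => Finset.sum_nonneg fun i _ => sq_nonneg _) hint t
  rw [integral_finsetSum _ fun i _ => (integral_sq_linearCombination hlaw hind (u i)).1,
    Finset.sum_congr rfl fun i hi => by
      rw [(integral_sq_linearCombination hlaw hind (u i)).2, hu i hi, mul_one],
    Finset.sum_const, nsmul_eq_mul] at h
  rw [le_div_iff₀ ht]
  calc _ ≤ P.real {ω | t ≤ ∑ i ∈ I, (∑ v, u i v * ε v ω) ^ 2} * t := by
        exact mul_le_mul_of_nonneg_right
          (measureReal_mono fun ω hω => le_of_lt (show t < _ from hω)) ht.le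
    _ ≤ _ := by linarith

end Gaussian

/-! ### The basic inequality for penalised least squares. -/

section Deterministic

variable {V E : Type*} [Fintype V] [Fintype E] [DecidableEq V]

/-- Parseval's identity for the rows of a square matrix with orthonormal rows. -/
lemma dotProduct_eq_sum_mulVec {U : Matrix V V ℝ} (hU : U * Uᵀ = 1) (x z : V → ℝ) :
    x ⬝ᵥ z = ∑ i, (U *ᵥ x) i * (U *ᵥ z) i := by
  have h : Uᵀ * U = 1 := mul_eq_one_comm.1 hU
  change _ = (U *ᵥ x) ⬝ᵥ (U *ᵥ z)
  rw [Matrix.dotProduct_mulVec, Matrix.vecMul_mulVec, h, Matrix.vecMul_one]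

lemma l1Norm_sub_le (x z : E → ℝ) : l1Norm (x - z) ≤ l1Norm x + l1Norm z := by
  unfold l1Norm
  rw [← Finset.sum_add_distrib]
  exact Finset.sum_le_sum fun i _ => abs_sub _ _

lemma dotProduct_le_mul_l1Norm {g x : E → ℝ} {l : ℝ} (hg : ∀ e, |g e| ≤ l) :
    g ⬝ᵥ x ≤ l * l1Norm x := by
  unfold l1Norm dotProduct
  rw [Finset.mul_sum]
  refine Finset.sum_le_sum fun e _ => ?_
  calc g e * x e ≤ |g e| * |x e| := by rw [← abs_mul]; exact le_abs_self _
    _ ≤ _ := mul_le_mul_of_nonneg_right (hg e) (abs_nonneg _)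

/-- The basic inequality for an `ℓ¹`-penalised least squares estimator, where the noise is split
along the orthonormal rows of `U`: the components in `I` are handled by Cauchy–Schwarz, the others
by duality between the sup norm and the `ℓ¹` norm. -/
lemma sum_sq_sub_le_of_isMinimizer {U : Matrix V V ℝ} (hU : U * Uᵀ = 1) (S : Matrix E V ℝ)
    (I : Finset V) (a : V → E → ℝ) (ha : ∀ i ∉ I, ∀ x, a i ⬝ᵥ (S *ᵥ x) = (U *ᵥ x) i)
    {y θ θ₀ : V → ℝ} {l : ℝ}
    (hmin : 1 / 2 * ∑ i, (y i - θ i) ^ 2 + l * l1Norm (S *ᵥ θ) ≤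
      1 / 2 * ∑ i, (y i - θ₀ i) ^ 2 + l * l1Norm (S *ᵥ θ₀))
    (hg : ∀ e, |∑ i ∈ Iᶜ, a i e * (U *ᵥ (y - θ₀)) i| ≤ l) :
    ∑ i, (θ i - θ₀ i) ^ 2 ≤
      4 * ∑ i ∈ I, (U *ᵥ (y - θ₀)) i ^ 2 + 8 * (l * l1Norm (S *ᵥ θ₀)) := by
  set ε := y - θ₀ with hε
  set Δ := θ - θ₀ with hΔ
  have hbasic : 1 / 2 * ∑ i, (θ i - θ₀ i) ^ 2 ≤
      ε ⬝ᵥ Δ + l * l1Norm (S *ᵥ θ₀) - l * l1Norm (S *ᵥ θ) := by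
    have e : ∑ i, (y i - θ i) ^ 2 =
        ∑ i, (y i - θ₀ i) ^ 2 - 2 * (ε ⬝ᵥ Δ) + ∑ i, (θ i - θ₀ i) ^ 2 := by
      simp only [dotProduct, Finset.mul_sum, hε, hΔ, Pi.sub_apply]
      rw [← Finset.sum_sub_distrib, ← Finset.sum_add_distrib]
      exact Finset.sum_congr rfl fun i _ => by ring
    linarith
  have hnorm : ∑ i, (θ i - θ₀ i) ^ 2 = ∑ i, (U *ᵥ Δ) i ^ 2 := by
    have := dotProduct_eq_sum_mulVec hU Δ Δ
    simpa [dotProduct, hΔ, sq] using this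
  have hsplit : ε ⬝ᵥ Δ = ∑ i ∈ I, (U *ᵥ ε) i * (U *ᵥ Δ) i + ∑ i ∈ Iᶜ, (U *ᵥ ε) i * (U *ᵥ Δ) i := by
    rw [dotProduct_eq_sum_mulVec hU, Finset.sum_add_sum_compl]
  -- Young's inequality with weight 1/4 leaves half of the quadratic term of `hbasic` on the left.
  have hlow : ∑ i ∈ I, (U *ᵥ ε) i * (U *ᵥ Δ) i ≤
      ∑ i ∈ I, (U *ᵥ ε) i ^ 2 + 1 / 4 * ∑ i, (θ i - θ₀ i) ^ 2 := by
    have h1 : ∑ i ∈ I, (U *ᵥ Δ) i ^ 2 ≤ ∑ i, (U *ᵥ Δ) i ^ 2 :=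
      Finset.sum_le_sum_of_subset_of_nonneg (Finset.subset_univ _) fun _ _ _ => sq_nonneg _
    have h2 : ∑ i ∈ I, (U *ᵥ ε) i * (U *ᵥ Δ) i ≤
        ∑ i ∈ I, ((U *ᵥ ε) i ^ 2 + 1 / 4 * (U *ᵥ Δ) i ^ 2) :=
      Finset.sum_le_sum fun i _ => by nlinarith [sq_nonneg ((U *ᵥ ε) i - 1 / 2 * (U *ᵥ Δ) i)]
    rw [Finset.sum_add_distrib, ← Finset.mul_sum] at h2
    linarith
  -- The term in `θ` here cancels against the one in `hbasic`.
  have hhigh : ∑ i ∈ Iᶜ, (U *ᵥ ε) i * (U *ᵥ Δ) i ≤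
      l * (l1Norm (S *ᵥ θ) + l1Norm (S *ᵥ θ₀)) := by
    have e : ∑ i ∈ Iᶜ, (U *ᵥ ε) i * (U *ᵥ Δ) i =
        (fun e => ∑ i ∈ Iᶜ, a i e * (U *ᵥ ε) i) ⬝ᵥ (S *ᵥ Δ) := by
      rw [Finset.sum_congr rfl fun i hi => by rw [← ha i (Finset.mem_compl.1 hi) Δ]]
      simp only [dotProduct, Finset.mul_sum, Finset.sum_mul]
      rw [Finset.sum_comm]
      exact Finset.sum_congr rfl fun _ _ => Finset.sum_congr rfl fun _ _ => by ring
    rw [e]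
    refine (dotProduct_le_mul_l1Norm hg).trans ?_
    -- The sign of `l` is read off from `hg` at some index; without an index both sides vanish.
    by_cases hE : Nonempty E
    · obtain ⟨e⟩ := hE
      refine mul_le_mul_of_nonneg_left ?_ ((abs_nonneg _).trans (hg e))
      rw [hΔ, Matrix.mulVec_sub]
      exact l1Norm_sub_le _ _
    · have := not_nonempty_iff.1 hE
      simp [l1Norm]
  linarith

end Deterministic

/-! ### The one-dimensional cosine basis and the path Laplacian. -/

section CosineBasis

/-- Each summand is sin(x(t+1)) - sin(xt), so the sum telescopes. -/
lemma two_sin_mul_sum_cos (x : ℝ) (N : ℕ) :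
    2 * Real.sin (x / 2) * ∑ t ∈ Finset.range N, Real.cos (x * (t + 1 / 2)) = Real.sin (x * N) := by
  induction N with
  | zero => simp
  | succ N ih =>
    rw [Finset.sum_range_succ, mul_add, ih]
    have h1 : x * (N : ℝ) = x * (N + 1 / 2) - x / 2 := by ring
    have h2 : x * ((N + 1 : ℕ) : ℝ) = x * (N + 1 / 2) + x / 2 := by push_cast; ring
    rw [h1, h2, Real.sin_sub, Real.sin_add]
    ring

lemma sum_cos_eq_zero {N : ℕ} {m : ℤ} (hm : m ≠ 0) (hm' : |m| < 2 * N) :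
    ∑ t ∈ Finset.range N, Real.cos (Real.pi * m / N * (t + 1 / 2)) = 0 := by
  have hN : (0 : ℝ) < N := by
    have : (0 : ℤ) < 2 * N := (abs_nonneg m).trans_lt hm'
    exact_mod_cast (by omega : 0 < N)
  have h := two_sin_mul_sum_cos (Real.pi * m / N) N
  have h1 : Real.sin (Real.pi * m / N * N) = 0 := by
    rw [div_mul_cancel₀ _ hN.ne', mul_comm]; exact Real.sin_int_mul_pi m
  rw [h1] at h
  -- If the sine factor vanished, m would be a nonzero multiple of 2N, against |m| < 2N.
  rcases mul_eq_zero.1 h with h2 | h2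
  · exfalso
    have h3 : Real.sin (Real.pi * m / N / 2) = 0 := by linarith
    obtain ⟨n, hn⟩ := Real.sin_eq_zero_iff.1 h3
    have h4 : (n : ℝ) * (2 * N) = m := by
      have := Real.pi_ne_zero
      field_simp at hn
      linarith
    have h5 : n * (2 * N) = m := by exact_mod_cast h4
    have hn0 : n ≠ 0 := by rintro rfl; simp at h5; exact hm h5.symm
    have h6 : 1 ≤ |n| := Int.one_le_abs hn0
    rw [← h5, abs_mul, abs_of_nonneg (by positivity : (0 : ℤ) ≤ 2 * N)] at hm'
    have : (0 : ℤ) ≤ N := by positivity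
    nlinarith
  · exact h2

/-- Summation by parts for cosines; there is no boundary term at `0`. -/
lemma sum_cos_diff_mul_diff (x : ℝ) (f : ℕ → ℝ) (M : ℕ) :
    ∑ t ∈ Finset.range M, (Real.cos (x * ((t + 1 : ℕ) + 1 / 2)) - Real.cos (x * (t + 1 / 2))) *
        (f (t + 1) - f t) =
      4 * Real.sin (x / 2) ^ 2 * ∑ t ∈ Finset.range (M + 1), Real.cos (x * (t + 1 / 2)) * f t -
        2 * Real.sin (x / 2) * Real.sin (x * (M + 1)) * f M := by
  induction M with
  | zero =>
    have h : x * ((0 : ℕ) + 1) = 2 * (x / 2) := by push_cast; ring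
    have h' : x * (((0 : ℕ) : ℝ) + 1 / 2) = x / 2 := by push_cast; ring
    rw [h, Real.sin_two_mul]
    simp only [Finset.sum_range_one, Finset.sum_range_zero, zero_add, h']
    ring
  | succ M ih =>
    rw [Finset.sum_range_succ, ih, Finset.sum_range_succ _ (M + 1)]
    have h1 : x * ((M + 1 : ℕ) + 1 / 2) = x * (M + 1) + x / 2 := by push_cast; ring
    have h2 : x * ((M : ℝ) + 1 / 2) = x * (M + 1) - x / 2 := by ring
    have h3 : x * ((M + 1 : ℕ) + 1) = x * (M + 1) + 2 * (x / 2) := by push_cast; ring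
    rw [h1, h2, h3, Real.sin_add, Real.cos_add, Real.cos_sub, Real.sin_two_mul, Real.cos_two_mul,
      Real.cos_sq']
    ring

/-- The orthonormal discrete cosine basis of `ℝ^N` (type II), extended to all `t : ℕ`. -/
def dct (N i t : ℕ) : ℝ :=
  √((if i = 0 then 1 else 2) / N) * Real.cos (Real.pi * i / N * (t + 1 / 2))

/-- The eigenvalues of the Laplacian of the path with `N` vertices. -/
def pathEigenvalue (N i : ℕ) : ℝ := 4 * Real.sin (Real.pi * i / N / 2) ^ 2

lemma pathEigenvalue_nonneg (N i : ℕ) : 0 ≤ pathEigenvalue N i := by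
  unfold pathEigenvalue; positivity

lemma dct_sq_le (N i t : ℕ) : dct N i t ^ 2 ≤ 2 / N := by
  unfold dct
  rw [mul_pow, Real.sq_sqrt (by positivity)]
  calc _ ≤ (2 : ℝ) / N * 1 := by
        gcongr
        · split_ifs <;> norm_num
        · exact Real.cos_sq_le_one _
    _ = _ := mul_one _

/-- A difference of consecutive cosines is -2 sin(x/2) times a sine, and 4 sin²(x/2) is the
eigenvalue. -/
lemma dct_diff_sq_le (N i t : ℕ) :
    (dct N i (t + 1) - dct N i t) ^ 2 ≤ 2 / N * pathEigenvalue N i := by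
  unfold dct pathEigenvalue
  set x := Real.pi * i / N
  have h1 : x * ((t + 1 : ℕ) + 1 / 2) = x * (t + 1) + x / 2 := by push_cast; ring
  have h2 : x * ((t : ℝ) + 1 / 2) = x * (t + 1) - x / 2 := by ring
  have h3 : Real.cos (x * (t + 1) + x / 2) - Real.cos (x * (t + 1) - x / 2) =
      -2 * Real.sin (x / 2) * Real.sin (x * (t + 1)) := by
    rw [Real.cos_add, Real.cos_sub]; ring
  rw [h1, h2, ← mul_sub, h3, mul_pow, Real.sq_sqrt (by positivity)]
  gcongr
  · split_ifs <;> norm_num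
  · nlinarith [sq_nonneg (Real.sin (x / 2)), Real.sin_sq_le_one (x * (t + 1))]

/-- The product formula turns the sum into cosine sums at the frequencies i - j and i + j, both
below 2N in absolute value; only a zero frequency survives. -/
lemma sum_dct_mul_dct {N i j : ℕ} (hi : i < N) (hj : j < N) :
    ∑ t ∈ Finset.range N, dct N i t * dct N j t = if i = j then 1 else 0 := by
  have hN : (0 : ℝ) < N := by exact_mod_cast (by omega : 0 < N)
  have hprod : ∀ t : ℕ, Real.cos (Real.pi * i / N * (t + 1 / 2)) *
      Real.cos (Real.pi * j / N * (t + 1 / 2)) =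
      1 / 2 * (Real.cos (Real.pi * ((i - j : ℤ) : ℝ) / N * (t + 1 / 2)) +
        Real.cos (Real.pi * ((i + j : ℤ) : ℝ) / N * (t + 1 / 2))) := by
    intro t
    have h1 : Real.pi * ((i - j : ℤ) : ℝ) / N * (t + 1 / 2) =
        Real.pi * i / N * (t + 1 / 2) - Real.pi * j / N * (t + 1 / 2) := by push_cast; ring
    have h2 : Real.pi * ((i + j : ℤ) : ℝ) / N * (t + 1 / 2) =
        Real.pi * i / N * (t + 1 / 2) + Real.pi * j / N * (t + 1 / 2) := by push_cast; ring
    rw [h1, h2, Real.cos_add, Real.cos_sub]; ring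
  have hsum : ∑ t ∈ Finset.range N, dct N i t * dct N j t =
      √((if i = 0 then 1 else 2) / N) * √((if j = 0 then 1 else 2) / N) * (1 / 2) *
      (∑ t ∈ Finset.range N, Real.cos (Real.pi * ((i - j : ℤ) : ℝ) / N * (t + 1 / 2)) +
        ∑ t ∈ Finset.range N, Real.cos (Real.pi * ((i + j : ℤ) : ℝ) / N * (t + 1 / 2))) := by
    rw [← Finset.sum_add_distrib, Finset.mul_sum]
    refine Finset.sum_congr rfl fun t _ => ?_
    unfold dct
    linear_combination √((if i = 0 then 1 else 2) / N) * √((if j = 0 then 1 else 2) / N) * hprod t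
  rw [hsum]
  by_cases hij : i = j
  · subst hij
    rw [if_pos rfl, Real.mul_self_sqrt (by positivity)]
    by_cases h0 : i = 0
    · subst h0
      simp
      field_simp
      norm_num
    · rw [sum_cos_eq_zero (m := (i + i : ℤ)) (by omega) (by rw [abs_of_nonneg] <;> omega)]
      simp [h0]
      field_simp
  · rw [if_neg hij,
      sum_cos_eq_zero (m := (i + j : ℤ)) (by omega) (by rw [abs_of_nonneg] <;> omega),
      sum_cos_eq_zero (m := (i - j : ℤ)) (by omega) (by rw [abs_lt]; constructor <;> omega)]
    simp

lemma sum_dct_diff_mul_diff {N i j : ℕ} (hi : i < N) (hj : j < N) :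
    ∑ t ∈ Finset.range N, (if t + 1 < N then
        (dct N i (t + 1) - dct N i t) * (dct N j (t + 1) - dct N j t) else 0) =
      if i = j then pathEigenvalue N i else 0 := by
  obtain ⟨M, rfl⟩ : ∃ M, N = M + 1 := ⟨N - 1, by omega⟩
  rw [Finset.sum_range_succ, if_neg (lt_irrefl _), add_zero,
    Finset.sum_congr rfl fun t ht => if_pos (Nat.succ_lt_succ (Finset.mem_range.1 ht))]
  have h := sum_cos_diff_mul_diff (Real.pi * i / (M + 1 : ℕ)) (dct (M + 1) j) M
  -- The right boundary term vanishes because the frequency is an integer multiple of π/N.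
  have h0 : Real.sin (Real.pi * i / (M + 1 : ℕ) * (M + 1)) = 0 := by
    have : Real.pi * i / (M + 1 : ℕ) * (M + 1) = i * Real.pi := by
      push_cast; field_simp
    rw [this]; exact Real.sin_nat_mul_pi i
  rw [h0, mul_zero, zero_mul, sub_zero] at h
  have h2 := sum_dct_mul_dct hi hj
  calc _ = √((if i = 0 then 1 else 2) / (M + 1 : ℕ)) *
        (4 * Real.sin (Real.pi * i / (M + 1 : ℕ) / 2) ^ 2 * ∑ t ∈ Finset.range (M + 1),
          Real.cos (Real.pi * i / (M + 1 : ℕ) * (t + 1 / 2)) * dct (M + 1) j t) := by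
        rw [← h, Finset.mul_sum]
        refine Finset.sum_congr rfl fun t _ => ?_
        simp only [dct]
        ring
    _ = pathEigenvalue (M + 1) i * ∑ t ∈ Finset.range (M + 1),
          dct (M + 1) i t * dct (M + 1) j t := by
        rw [Finset.mul_sum, Finset.mul_sum, Finset.mul_sum]
        refine Finset.sum_congr rfl fun t _ => ?_
        simp only [dct, pathEigenvalue]
        ring
    _ = _ := by rw [h2]; split_ifs <;> simp

/-- Jordan's inequality: sin x ≥ 2x/π on [0, π/2]. -/
lemma four_mul_sq_le_pathEigenvalue {N i : ℕ} (hi : i < N) :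
    4 * ((i : ℝ) / N) ^ 2 ≤ pathEigenvalue N i := by
  have hN : (0 : ℝ) < N := by exact_mod_cast (by omega : 0 < N)
  have hiN : (i : ℝ) ≤ N := by exact_mod_cast hi.le
  have h := Real.mul_le_sin (x := Real.pi * i / N / 2) (by positivity) (by
    rw [mul_div_assoc]
    have := Real.pi_pos
    have : (i : ℝ) / N ≤ 1 := (div_le_one hN).2 hiN
    nlinarith)
  have e : 2 / Real.pi * (Real.pi * i / N / 2) = (i : ℝ) / N := by
    have := Real.pi_ne_zero
    field_simp
  rw [e] at h
  unfold pathEigenvalue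
  gcongr

end CosineBasis

/-! ### The tensor cosine basis and the grid Laplacian. -/

section GridBasis

variable {d N : ℕ}

/-- The tensor product cosine basis on the grid, as a matrix whose rows are the basis vectors. -/
def gridDct (d N : ℕ) : Matrix (Grid d N) (Grid d N) ℝ :=
  fun i v => ∏ j, dct N (i j) (v j)

/-- The eigenvalues of the grid Laplacian. -/
def gridEigenvalue (i : Grid d N) : ℝ := ∑ j, pathEigenvalue N (i j)

lemma sum_prod_grid (g : Fin d → Fin N → ℝ) :
    ∑ v : Grid d N, ∏ j, g j (v j) = ∏ j, ∑ t, g j t := by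
  rw [Finset.prod_univ_sum, Fintype.piFinset_univ]

lemma prod_ite_eq_ite (i i' : Grid d N) :
    ∏ j, (if (i j : ℕ) = i' j then (1 : ℝ) else 0) = if i = i' then 1 else 0 := by
  rw [Finset.prod_ite_zero]
  simp [funext_iff, Fin.ext_iff]

lemma gridDct_mul_transpose : gridDct d N * (gridDct d N)ᵀ = 1 := by
  ext i i'
  rw [Matrix.mul_apply, Matrix.one_apply, ← prod_ite_eq_ite]
  simp only [Matrix.transpose_apply, gridDct, ← Finset.prod_mul_distrib]
  rw [sum_prod_grid fun j t => dct N (i j) t * dct N (i' j) t]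
  refine Finset.prod_congr rfl fun j _ => ?_
  rw [Fin.sum_univ_eq_sum_range (fun t => dct N (i j) t * dct N (i' j) t) N,
    sum_dct_mul_dct (i j).2 (i' j).2]

lemma gridDct_sq_le (i v : Grid d N) : gridDct d N i v ^ 2 ≤ (2 / N : ℝ) ^ d := by
  unfold gridDct
  rw [← Finset.prod_pow]
  refine (Finset.prod_le_prod (fun _ _ => sq_nonneg _) fun j _ => dct_sq_le N (i j) (v j)).trans ?_
  rw [Finset.prod_const, Finset.card_univ, Fintype.card_fin]

/-- The difference of the `i`-th basis function in direction `j` at `v`. -/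
def gridDctDiff (i : Grid d N) (j : Fin d) (v : Grid d N) : ℝ :=
  ∏ l, if l = j then dct N (i l) (v l + 1) - dct N (i l) (v l) else dct N (i l) (v l)

/-- The gain of a factor μ_i is what lets odd orders obey the same variance bound as even ones. -/
lemma gridDctDiff_sq_le (i : Grid d N) (j : Fin d) (v : Grid d N) :
    gridDctDiff i j v ^ 2 ≤ (2 / N : ℝ) ^ d * gridEigenvalue i := by
  unfold gridDctDiff
  rw [← Finset.prod_pow]
  calc _ ≤ ∏ l : Fin d, (2 / N : ℝ) * (if l = j then pathEigenvalue N (i j) else 1) := by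
        refine Finset.prod_le_prod (fun _ _ => sq_nonneg _) fun l _ => ?_
        split_ifs with h
        · subst h; exact dct_diff_sq_le _ _ _
        · rw [mul_one]; exact dct_sq_le _ _ _
    _ = (2 / N : ℝ) ^ d * pathEigenvalue N (i j) := by
        rw [Finset.prod_mul_distrib, Finset.prod_const, Finset.card_univ, Fintype.card_fin]; simp
    _ ≤ _ := by
        gcongr
        exact Finset.single_le_sum (f := fun j => pathEigenvalue N (i j))
          (fun j _ => pathEigenvalue_nonneg _ _) (Finset.mem_univ j)

lemma incidence_mulVec (x : Grid d N → ℝ) (e : Edge d N) :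
    (incidence d N *ᵥ x) e = x e.head - x e.tail := by
  simp [incidence, Matrix.mulVec, dotProduct, sub_mul, Finset.sum_sub_distrib]

lemma incidence_mul_transpose_gridDct (e : Edge d N) (i : Grid d N) :
    (incidence d N * (gridDct d N)ᵀ) e i = gridDctDiff i e.1.1 e.1.2 := by
  have h := incidence_mulVec (gridDct d N i) e
  have h' : (incidence d N * (gridDct d N)ᵀ) e i = (incidence d N *ᵥ gridDct d N i) e := rfl
  rw [h', h]
  obtain ⟨⟨j, v⟩, hv⟩ := e
  simp only [Edge.head, Edge.tail, gridDct, gridDctDiff]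
  rw [← Finset.mul_prod_erase _ _ (Finset.mem_univ j),
    ← Finset.mul_prod_erase _ (fun l => dct N (i l) (v l)) (Finset.mem_univ j),
    ← Finset.mul_prod_erase _ (fun l => if l = j then dct N (i l) (v l + 1) - dct N (i l) (v l)
      else dct N (i l) (v l)) (Finset.mem_univ j)]
  have e1 : ∏ l ∈ Finset.univ.erase j,
      dct N (i l) (Function.update v j ⟨(v j : ℕ) + 1, hv⟩ l) =
      ∏ l ∈ Finset.univ.erase j, dct N (i l) (v l) :=
    Finset.prod_congr rfl fun l hl => by rw [Function.update_of_ne (Finset.ne_of_mem_erase hl)]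
  have e2 : ∏ l ∈ Finset.univ.erase j, (if l = j then dct N (i l) (v l + 1) - dct N (i l) (v l)
      else dct N (i l) (v l)) = ∏ l ∈ Finset.univ.erase j, dct N (i l) (v l) :=
    Finset.prod_congr rfl fun l hl => if_neg (Finset.ne_of_mem_erase hl)
  rw [e1, e2]
  simp
  ring

/-- The left side is the Gram matrix of the edge differences Du_i; in each direction j the sum over
edges factorises over coordinates. -/
lemma gridDct_mul_laplacian_mul_transpose :
    gridDct d N * laplacian d N * (gridDct d N)ᵀ = Matrix.diagonal gridEigenvalue := by
  have h : gridDct d N * laplacian d N * (gridDct d N)ᵀ =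
      (incidence d N * (gridDct d N)ᵀ)ᵀ * (incidence d N * (gridDct d N)ᵀ) := by
    rw [laplacian, Matrix.transpose_mul, Matrix.transpose_transpose]
    simp only [Matrix.mul_assoc]
  rw [h]
  ext i i'
  rw [Matrix.mul_apply, Matrix.diagonal_apply]
  simp only [Matrix.transpose_apply, incidence_mul_transpose_gridDct]
  rw [← Finset.sum_subtype (Finset.univ.filter fun e : Fin d × Grid d N => (e.2 e.1 : ℕ) + 1 < N)
    (by simp) (fun e => gridDctDiff i e.1 e.2 * gridDctDiff i' e.1 e.2), Finset.sum_filter,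
    Fintype.sum_prod_type]
  have hj : ∀ j : Fin d, ∑ v : Grid d N, (if (v j : ℕ) + 1 < N then
      gridDctDiff i j v * gridDctDiff i' j v else 0) =
      pathEigenvalue N (i j) * if i = i' then 1 else 0 := by
    intro j
    -- The restriction to genuine edges is moved into the factor of coordinate j, so that the sum
    -- over vertices becomes a product of one-dimensional sums.
    obtain ⟨g, hg⟩ : ∃ g : Fin d → Fin N → ℝ, ∀ l t, g l t =
        if l = j then (if (t : ℕ) + 1 < N then
          (dct N (i l) (t + 1) - dct N (i l) t) * (dct N (i' l) (t + 1) - dct N (i' l) t) else 0)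
          else dct N (i l) t * dct N (i' l) t := ⟨_, fun _ _ => rfl⟩
    have e1 : ∀ v : Grid d N, (if (v j : ℕ) + 1 < N then
        gridDctDiff i j v * gridDctDiff i' j v else 0) = ∏ l, g l (v l) := by
      intro v
      split_ifs with hv
      · rw [gridDctDiff, gridDctDiff, ← Finset.prod_mul_distrib]
        refine Finset.prod_congr rfl fun l _ => ?_
        by_cases hl : l = j
        · subst hl; simp [hv, hg]
        · simp [hl, hg]
      · exact (Finset.prod_eq_zero (Finset.mem_univ j) (by simp [hv, hg])).symm
    rw [Finset.sum_congr rfl fun v _ => e1 v, ← prod_ite_eq_ite, sum_prod_grid]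
    have e2 : ∀ l : Fin d, ∑ t, g l t =
        (if l = j then pathEigenvalue N (i j) else 1) * if (i l : ℕ) = i' l then 1 else 0 := by
      intro l
      simp only [hg]
      by_cases hl : l = j
      · subst hl
        simp only [if_true]
        rw [Fin.sum_univ_eq_sum_range (fun t => if t + 1 < N then
          (dct N (i l) (t + 1) - dct N (i l) t) * (dct N (i' l) (t + 1) - dct N (i' l) t) else 0) N,
          sum_dct_diff_mul_diff (i l).2 (i' l).2]
        simp
      · simp only [if_neg hl]
        rw [Fin.sum_univ_eq_sum_range (fun t => dct N (i l) t * dct N (i' l) t) N,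
          sum_dct_mul_dct (i l).2 (i' l).2, one_mul]
    rw [Finset.prod_congr rfl fun l _ => e2 l, Finset.prod_mul_distrib]
    simp
  rw [Finset.sum_congr rfl fun j _ => hj j, ← Finset.sum_mul, gridEigenvalue]
  simp

lemma gridDct_mulVec_laplacian_pow (q : ℕ) (x : Grid d N → ℝ) (i : Grid d N) :
    (gridDct d N *ᵥ (laplacian d N ^ q *ᵥ x)) i =
      gridEigenvalue i ^ q * (gridDct d N *ᵥ x) i := by
  have hU : (gridDct d N)ᵀ * gridDct d N = 1 := mul_eq_one_comm.1 gridDct_mul_transpose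
  have h1 : gridDct d N * laplacian d N = Matrix.diagonal gridEigenvalue * gridDct d N := by
    rw [← gridDct_mul_laplacian_mul_transpose, Matrix.mul_assoc, hU, Matrix.mul_one]
  have hq : gridDct d N * laplacian d N ^ q =
      Matrix.diagonal (fun i => gridEigenvalue i ^ q) * gridDct d N := by
    induction q with
    | zero => simp
    | succ q ih =>
      rw [pow_succ, ← Matrix.mul_assoc, ih, Matrix.mul_assoc, h1, ← Matrix.mul_assoc,
        Matrix.diagonal_mul_diagonal]
      simp only [pow_succ]
  rw [Matrix.mulVec_mulVec, hq, ← Matrix.mulVec_mulVec, Matrix.mulVec_diagonal]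

/-- The graph trend filtering operator of even order `2q` pairs with the rescaled cosine basis to
give the coefficients in that basis. -/
lemma dotProduct_laplacian_pow_mulVec {q : ℕ} {i : Grid d N} (hi : gridEigenvalue i ≠ 0)
    (x : Grid d N → ℝ) :
    (fun v => (gridEigenvalue i ^ q)⁻¹ * gridDct d N i v) ⬝ᵥ (laplacian d N ^ q *ᵥ x) =
      (gridDct d N *ᵥ x) i := by
  have h := gridDct_mulVec_laplacian_pow q x i
  have e : (fun v => (gridEigenvalue i ^ q)⁻¹ * gridDct d N i v) =
      (gridEigenvalue i ^ q)⁻¹ • gridDct d N i := rfl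
  rw [e, smul_dotProduct, smul_eq_mul]
  change _ * (gridDct d N *ᵥ (laplacian d N ^ q *ᵥ x)) i = _
  rw [h, inv_mul_cancel_left₀ (pow_ne_zero _ hi)]

/-- The analogue of `dotProduct_laplacian_pow_mulVec` for odd order `2q + 1`. -/
lemma dotProduct_incidence_mul_laplacian_pow_mulVec {q : ℕ} {i : Grid d N}
    (hi : gridEigenvalue i ≠ 0) (x : Grid d N → ℝ) :
    (fun e : Edge d N => (gridEigenvalue i ^ (q + 1))⁻¹ * gridDctDiff i e.1.1 e.1.2) ⬝ᵥ
      ((incidence d N * laplacian d N ^ q) *ᵥ x) = (gridDct d N *ᵥ x) i := by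
  have e : (fun e : Edge d N => (gridEigenvalue i ^ (q + 1))⁻¹ * gridDctDiff i e.1.1 e.1.2) =
      (gridEigenvalue i ^ (q + 1))⁻¹ • (incidence d N *ᵥ gridDct d N i) := by
    ext e
    rw [← incidence_mul_transpose_gridDct e i]
    rfl
  -- Moving D across the pairing produces DᵀD L^q = L^(q+1).
  rw [e, smul_dotProduct, smul_eq_mul, ← Matrix.mulVec_mulVec, ← Matrix.vecMul_transpose,
    ← Matrix.dotProduct_mulVec, Matrix.mulVec_mulVec, ← laplacian,
    Matrix.mulVec_mulVec, ← pow_succ']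
  change _ * (gridDct d N *ᵥ (laplacian d N ^ (q + 1) *ᵥ x)) i = _
  rw [gridDct_mulVec_laplacian_pow, inv_mul_cancel_left₀ (pow_ne_zero _ hi)]

end GridBasis

/-! ### High-probability error bounds. -/

section Concentration

variable {Ω : Type*} [MeasurableSpace Ω] {P : Measure Ω} [IsProbabilityMeasure P] {s : NNReal}

/-- A high probability error bound for `ℓ¹`-penalised least squares with Gaussian noise. -/
lemma measure_sum_sq_sub_gt_le {V E : Type*} [Fintype V] [Fintype E] [DecidableEq V]
    {U : Matrix V V ℝ} (hU : U * Uᵀ = 1) (S : Matrix E V ℝ)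
    (I : Finset V) (a : V → E → ℝ) (ha : ∀ i ∉ I, ∀ x, a i ⬝ᵥ (S *ᵥ x) = (U *ᵥ x) i)
    {W : ℝ} (haW : ∀ e, ∑ i ∈ Iᶜ, a i e ^ 2 ≤ W)
    {y θhat : Ω → V → ℝ} {θ₀ : V → ℝ} {l t : ℝ} (hl : 0 ≤ l) (ht : 0 < t)
    (hlaw : ∀ v, HasLaw (fun ω => y ω v) (gaussianReal (θ₀ v) s) P)
    (hind : iIndepFun (fun v ω => y ω v) P)
    (hmin : ∀ ω, 1 / 2 * ∑ i, (y ω i - θhat ω i) ^ 2 + l * l1Norm (S *ᵥ θhat ω) ≤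
      1 / 2 * ∑ i, (y ω i - θ₀ i) ^ 2 + l * l1Norm (S *ᵥ θ₀)) :
    P {ω | 4 * t + 8 * (l * l1Norm (S *ᵥ θ₀)) < ∑ i, (θhat ω i - θ₀ i) ^ 2} ≤
      ENNReal.ofReal (Fintype.card E * (2 * Real.exp (-l ^ 2 / (2 * (s * W)))) +
        s * I.card / t) := by
  set ε : V → Ω → ℝ := fun v ω => y ω v - θ₀ v with hε
  have hεlaw : ∀ v, HasLaw (ε v) (gaussianReal 0 s) P := fun v => by
    simpa using gaussianReal_sub_const (hlaw v) (θ₀ v)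
  have hεind : iIndepFun ε P :=
    hind.comp (fun v x => x - θ₀ v) fun v => measurable_id.sub_const _
  -- The coefficients of g_e as a linear form in the noise.
  let b : E → V → ℝ := fun e v => ∑ i ∈ Iᶜ, a i e * U i v
  have hb : ∀ e ω, ∑ v, b e v * ε v ω = ∑ i ∈ Iᶜ, a i e * (U *ᵥ (y ω - θ₀)) i := by
    intro e ω
    simp only [b, Finset.sum_mul, Matrix.mulVec, dotProduct, Finset.mul_sum]
    rw [Finset.sum_comm]
    exact Finset.sum_congr rfl fun _ _ => Finset.sum_congr rfl fun _ _ => by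
      simp only [hε, Pi.sub_apply]; ring
  -- Multiplication by the orthogonal `U` preserves the norm of the coefficient vector.
  have hbW : ∀ e, ∑ v, b e v ^ 2 ≤ W := by
    intro e
    refine le_trans (le_of_eq ?_) (haW e)
    let c : V → ℝ := fun i => if i ∈ Iᶜ then a i e else 0
    have e1 : b e = c ᵥ* U := by
      ext v
      simp only [b, c, Matrix.vecMul, dotProduct, ite_mul, zero_mul, Finset.sum_ite_mem,
        Finset.univ_inter]
    calc ∑ v, b e v ^ 2 = (c ᵥ* U) ⬝ᵥ (c ᵥ* U) := by simp [e1, dotProduct, sq]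
      _ = c ⬝ᵥ c := by
        rw [← Matrix.dotProduct_mulVec, ← Matrix.vecMul_transpose, Matrix.vecMul_vecMul, hU,
          Matrix.vecMul_one]
      _ = _ := by
        simp only [c, dotProduct, mul_ite, ite_mul, mul_zero, zero_mul, ← ite_and,
          and_self, Finset.sum_ite_mem, Finset.univ_inter, sq]
  have hUrow : ∀ i ∈ I, ∑ v, U i v ^ 2 = 1 := by
    intro i _
    have := congrFun (congrFun hU i) i
    rw [Matrix.mul_apply, Matrix.one_apply_eq] at this
    simpa [sq] using this
  -- Outside the two bad events the deterministic inequality applies.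
  have hsub : {ω | 4 * t + 8 * (l * l1Norm (S *ᵥ θ₀)) < ∑ i, (θhat ω i - θ₀ i) ^ 2} ⊆
      (⋃ e ∈ (Finset.univ : Finset E), {ω | l < |∑ v, b e v * ε v ω|}) ∪
        {ω | t < ∑ i ∈ I, (∑ v, U i v * ε v ω) ^ 2} := by
    intro ω hω
    by_contra hcon
    simp only [Set.mem_union, Set.mem_iUnion, Set.mem_ofPred_eq, not_or, not_exists, not_lt,
      Finset.mem_univ, true_implies] at hcon
    have h := sum_sq_sub_le_of_isMinimizer hU S I a ha (hmin ω)
      (fun e => by rw [← hb]; exact hcon.1 e)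
    have h2 : ∑ i ∈ I, (U *ᵥ (y ω - θ₀)) i ^ 2 ≤ t := hcon.2
    have h3 : 4 * t + 8 * (l * l1Norm (S *ᵥ θ₀)) < ∑ i, (θhat ω i - θ₀ i) ^ 2 := hω
    linarith
  rw [← ENNReal.toReal_le_toReal (measure_ne_top _ _) ENNReal.ofReal_ne_top,
    ENNReal.toReal_ofReal (by positivity)]
  change P.real _ ≤ _
  calc _ ≤ _ := measureReal_mono hsub
    _ ≤ _ := measureReal_union_le _ _
    _ ≤ _ := add_le_add (measureReal_biUnion_finset_le _ _)
        (measure_sum_sq_linearCombination_gt_le hεlaw hεind I U hUrow ht)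
    _ ≤ _ := by
      gcongr
      calc _ ≤ ∑ e : E, 2 * Real.exp (-l ^ 2 / (2 * (s * W))) :=
            Finset.sum_le_sum fun e _ =>
              measure_abs_linearCombination_gt_le hεlaw hεind (b e) (hbW e) hl
        _ = _ := by simp [Finset.card_univ]

variable {d N : ℕ}

lemma card_edge_le : Fintype.card (Edge d N) ≤ d * N ^ d := by
  refine (Fintype.card_subtype_le _).trans ?_
  simp

lemma gridEigenvalue_nonneg (i : Grid d N) : 0 ≤ gridEigenvalue i :=
  Finset.sum_nonneg fun j _ => pathEigenvalue_nonneg N (i j)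

/-- The error of graph trend filtering on a grid, in terms of the split of the cosine basis into
the low frequencies `I` and the others. -/
lemma measure_gtf_error_gt_le (hd : 1 ≤ d) {k : ℕ} (I : Finset (Grid d N))
    (hI : ∀ i ∉ I, gridEigenvalue i ≠ 0) {W : ℝ}
    (hW : (2 / N : ℝ) ^ d * ∑ i ∈ Iᶜ, (gridEigenvalue i ^ (k + 1))⁻¹ ≤ W)
    {y θhat : Ω → Grid d N → ℝ} {θ₀ : Grid d N → ℝ} {l t : ℝ} (hl : 0 ≤ l) (ht : 0 < t)
    (hlaw : ∀ v, HasLaw (fun ω => y ω v) (gaussianReal (θ₀ v) s) P)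
    (hind : iIndepFun (fun v ω => y ω v) P)
    (hmin : ∀ ω, IsGTF d N k l (y ω) (θhat ω)) :
    P {ω | 4 * t + 8 * (l * gtfPenalty d N (k + 1) θ₀) < ∑ i, (θhat ω i - θ₀ i) ^ 2} ≤
      ENNReal.ofReal (d * (N : ℝ) ^ d * (2 * Real.exp (-l ^ 2 / (2 * (s * W)))) +
        s * I.card / t) := by
  have hmin' := fun ω => hmin ω θ₀
  simp only [gtfObjective, gtfPenalty] at hmin' ⊢
  by_cases hk : Even (k + 1)
  · simp only [if_pos hk] at hmin' ⊢
    set q := (k + 1) / 2 with hq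
    have hkq : k + 1 = 2 * q := by have := hk.two_dvd; omega
    refine (measure_sum_sq_sub_gt_le gridDct_mul_transpose (laplacian d N ^ q) I
      (fun i v => (gridEigenvalue i ^ q)⁻¹ * gridDct d N i v)
      (fun i hi x => dotProduct_laplacian_pow_mulVec (hI i hi) x) (fun v => le_trans ?_ hW)
      hl ht hlaw hind hmin').trans (ENNReal.ofReal_le_ofReal ?_)
    · rw [Finset.mul_sum]
      refine Finset.sum_le_sum fun i _ => ?_
      rw [mul_pow, hkq, pow_mul', inv_pow, mul_comm]
      gcongr
      exact gridDct_sq_le i v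
    · gcongr
      -- In even order the rows of S are the N^d vertices; weakening to d N^d gives one bound for
      -- both parities.
      have : (1 : ℝ) ≤ d := by exact_mod_cast hd
      simp only [Fintype.card_fun, Fintype.card_fin, Nat.cast_pow]
      exact le_mul_of_one_le_left (by positivity) this
  · simp only [if_neg hk] at hmin' ⊢
    set q := (k + 1) / 2 with hq
    have hkq : k + 1 = 2 * q + 1 := by
      have := Nat.not_even_iff_odd.1 hk
      obtain ⟨r, hr⟩ := this
      omega
    refine (measure_sum_sq_sub_gt_le gridDct_mul_transpose (incidence d N * laplacian d N ^ q) I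
      (fun i e => (gridEigenvalue i ^ (q + 1))⁻¹ * gridDctDiff i e.1.1 e.1.2)
      (fun i hi x => dotProduct_incidence_mul_laplacian_pow_mulVec (hI i hi) x)
      (fun e => le_trans ?_ hW) hl ht hlaw hind hmin').trans (ENNReal.ofReal_le_ofReal ?_)
    · rw [Finset.mul_sum]
      refine Finset.sum_le_sum fun i hi => ?_
      have h0 := hI i (Finset.mem_compl.1 hi)
      have h1 := gridEigenvalue_nonneg i
      -- One of the 2(q+1) inverse eigenvalue factors is cancelled, leaving 2q + 1 = k + 1.
      calc _ ≤ ((gridEigenvalue i ^ (q + 1))⁻¹) ^ 2 * ((2 / N : ℝ) ^ d * gridEigenvalue i) := by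
            rw [mul_pow]
            gcongr
            exact gridDctDiff_sq_le i _ _
        _ = _ := by
            rw [hkq]
            field_simp
            ring
    · gcongr
      exact_mod_cast card_edge_le

end Concentration

/-! ### Sums of inverse eigenvalues over high frequencies. -/

section LatticeSums

variable {d N : ℕ}

/-- The frequencies all of whose coordinates are less than `R`. -/
def lowFrequencies (d N R : ℕ) : Finset (Grid d N) :=
  Finset.univ.filter fun i => ∀ j, (i j : ℕ) < R

lemma mem_lowFrequencies {R : ℕ} {i : Grid d N} :
    i ∈ lowFrequencies d N R ↔ ∀ j, (i j : ℕ) < R := by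
  simp [lowFrequencies]

lemma card_lowFrequencies (R : ℕ) : (lowFrequencies d N R).card = min N R ^ d := by
  have h : lowFrequencies d N R =
      Fintype.piFinset fun _ : Fin d => Finset.univ.filter fun t : Fin N => (t : ℕ) < R := by
    ext i; simp [lowFrequencies]
  rw [h, Fintype.card_piFinset]
  simp [Fin.card_filter_val_lt]

lemma lowFrequencies_mono {R R' : ℕ} (h : R ≤ R') :
    lowFrequencies d N R ⊆ lowFrequencies d N R' := fun _ hi =>
  mem_lowFrequencies.2 fun j => (mem_lowFrequencies.1 hi j).trans_le h

lemma succ_pow_sub_pow_le (r d : ℕ) :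
    ((r : ℝ) + 1) ^ d - (r : ℝ) ^ d ≤ d * ((r : ℝ) + 1) ^ (d - 1) := by
  have h := (le_abs_self _).trans (abs_pow_sub_pow_le ((r : ℝ) + 1) (r : ℝ) d)
  have hr : (0 : ℝ) ≤ r := r.cast_nonneg
  rwa [add_sub_cancel_left, abs_one, one_mul, abs_of_nonneg hr, abs_of_nonneg (by linarith),
    max_eq_left (by linarith)] at h

/-- The complement is cut into cubic shells; the one at radius r has (r+1)^d - r^d points. -/
lemma sum_compl_lowFrequencies_le {R : ℕ} {f : Grid d N → ℝ} {g : ℕ → ℝ}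
    (hg : ∀ r, 0 ≤ g r) (hfg : ∀ r, R ≤ r → ∀ i ∉ lowFrequencies d N r, f i ≤ g r) :
    ∑ i ∈ (lowFrequencies d N R)ᶜ, f i ≤
      ∑ r ∈ Finset.Ico R N, d * ((r : ℝ) + 1) ^ (d - 1) * g r := by
  have key : ∀ M, R ≤ M → M ≤ N → ∑ i ∈ lowFrequencies d N M \ lowFrequencies d N R, f i ≤
      ∑ r ∈ Finset.Ico R M, d * ((r : ℝ) + 1) ^ (d - 1) * g r := by
    intro M hRM
    induction M, hRM using Nat.le_induction with
    | base => intro _; simp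
    | succ M hRM ih =>
      intro hMN
      rw [Finset.sum_Ico_succ_top hRM, ← Finset.sum_sdiff
        (Finset.sdiff_subset_sdiff (lowFrequencies_mono (d := d) (N := N) M.le_succ)
          (subset_refl (lowFrequencies d N R))), add_comm]
      refine add_le_add (ih (by omega)) ?_
      have hset : (lowFrequencies d N (M + 1) \ lowFrequencies d N R) \
          (lowFrequencies d N M \ lowFrequencies d N R) =
          lowFrequencies d N (M + 1) \ lowFrequencies d N M := by
        ext i
        have := fun h => @lowFrequencies_mono d N R M hRM i h
        simp only [Finset.mem_sdiff]
        tauto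
      rw [hset]
      calc _ ≤ ∑ i ∈ lowFrequencies d N (M + 1) \ lowFrequencies d N M, g M :=
            Finset.sum_le_sum fun i hi => hfg M hRM i (Finset.mem_sdiff.1 hi).2
        _ = (((M : ℝ) + 1) ^ d - (M : ℝ) ^ d) * g M := by
            rw [Finset.sum_const, nsmul_eq_mul,
              Finset.cast_card_sdiff (lowFrequencies_mono M.le_succ), card_lowFrequencies,
              card_lowFrequencies, min_eq_right hMN, min_eq_right (by omega)]
            push_cast; rfl
        _ ≤ _ := mul_le_mul_of_nonneg_right (succ_pow_sub_pow_le M d) (hg M)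
  have hN : lowFrequencies d N N = Finset.univ := by
    ext i; simp [mem_lowFrequencies]
  rcases le_total R N with h | h
  · have := key N h le_rfl
    rwa [hN, ← Finset.compl_eq_univ_sdiff] at this
  · have : lowFrequencies d N R = Finset.univ :=
      Finset.univ_subset_iff.1 (hN ▸ lowFrequencies_mono h)
    rw [this, Finset.Ico_eq_empty_of_le h]
    simp

lemma le_gridEigenvalue {R : ℕ} {i : Grid d N} (hi : i ∉ lowFrequencies d N R) :
    4 * ((R : ℝ) / N) ^ 2 ≤ gridEigenvalue i := by
  rw [mem_lowFrequencies] at hi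
  push Not at hi
  obtain ⟨j, hj⟩ := hi
  have hj' : (R : ℝ) ≤ (i j : ℕ) := by exact_mod_cast hj
  calc 4 * ((R : ℝ) / N) ^ 2 ≤ 4 * (((i j : ℕ) : ℝ) / N) ^ 2 := by gcongr
    _ ≤ pathEigenvalue N (i j) := four_mul_sq_le_pathEigenvalue (i j).2
    _ ≤ _ := Finset.single_le_sum (f := fun j => pathEigenvalue N (i j))
      (fun j _ => pathEigenvalue_nonneg _ _) (Finset.mem_univ j)

/-- Only the constant vector has eigenvalue zero, and any cutoff R ≥ 1 counts it as low frequency.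
-/
lemma gridEigenvalue_ne_zero {R : ℕ} (hR : 1 ≤ R) {i : Grid d N}
    (hi : i ∉ lowFrequencies d N R) : gridEigenvalue i ≠ 0 := by
  have hN : N ≠ 0 := by
    rintro rfl
    exact hi (mem_lowFrequencies.2 fun j => (i j).elim0)
  refine (lt_of_lt_of_le ?_ (le_gridEigenvalue hi)).ne'
  have : (0 : ℝ) < N := by positivity
  have : (0 : ℝ) < R := by exact_mod_cast hR
  positivity

/-- The noise level of the high frequencies is controlled by a one-dimensional sum. -/
lemma sum_inv_gridEigenvalue_pow_le (hN : 1 ≤ N) {R : ℕ} (hR : 1 ≤ R) (m : ℕ) :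
    (2 / N : ℝ) ^ d * ∑ i ∈ (lowFrequencies d N R)ᶜ, (gridEigenvalue i ^ m)⁻¹ ≤
      4 ^ d * d * ((N : ℝ) ^ (2 * m) / (N : ℝ) ^ d *
        ∑ r ∈ Finset.Ico R N, (r : ℝ) ^ (d - 1) / (r : ℝ) ^ (2 * m)) := by
  have hN0 : (0 : ℝ) < N := by exact_mod_cast hN
  have h := sum_compl_lowFrequencies_le (d := d) (N := N) (R := R)
    (f := fun i => (gridEigenvalue i ^ m)⁻¹) (g := fun r => (N : ℝ) ^ (2 * m) / (r : ℝ) ^ (2 * m))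
    (fun r => by positivity) (fun r hr i hi => by
      have hr0 : (0 : ℝ) < r := by exact_mod_cast hR.trans hr
      have h1 : ((r : ℝ) / N) ^ 2 ≤ gridEigenvalue i :=
        le_trans (by nlinarith [sq_nonneg ((r : ℝ) / N)]) (le_gridEigenvalue hi)
      have h2 : (N : ℝ) ^ (2 * m) / (r : ℝ) ^ (2 * m) = ((((r : ℝ) / N) ^ 2) ^ m)⁻¹ := by
        rw [← pow_mul, div_pow, inv_div]
      rw [h2]
      gcongr)
  calc _ ≤ (2 / N : ℝ) ^ d * ∑ r ∈ Finset.Ico R N,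
        d * ((r : ℝ) + 1) ^ (d - 1) * ((N : ℝ) ^ (2 * m) / (r : ℝ) ^ (2 * m)) := by gcongr
    -- Here r + 1 ≤ 2r; with the 2^d of the basis bound this makes the constant 4^d d.
    _ ≤ (2 / N : ℝ) ^ d * ∑ r ∈ Finset.Ico R N,
        d * (2 ^ d * (r : ℝ) ^ (d - 1)) * ((N : ℝ) ^ (2 * m) / (r : ℝ) ^ (2 * m)) := by
      gcongr with r hr
      have hr1 : (1 : ℝ) ≤ r := by exact_mod_cast hR.trans (Finset.mem_Ico.1 hr).1
      calc ((r : ℝ) + 1) ^ (d - 1) ≤ (2 * r) ^ (d - 1) := by gcongr; linarith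
        _ = 2 ^ (d - 1) * (r : ℝ) ^ (d - 1) := mul_pow _ _ _
        _ ≤ _ := by
          gcongr
          · norm_num
          · omega
    _ = _ := by
      rw [Finset.mul_sum, Finset.mul_sum, Finset.mul_sum]
      refine Finset.sum_congr rfl fun r _ => ?_
      have : (4 : ℝ) ^ d = 2 ^ d * 2 ^ d := by rw [← mul_pow]; norm_num
      rw [div_pow, this]
      ring

lemma sum_pow_div_pow_le_of_lt {m : ℕ} (h : 2 * m < d) (hN : 1 ≤ N) :
    (N : ℝ) ^ (2 * m) / (N : ℝ) ^ d *
      ∑ r ∈ Finset.Ico 1 N, (r : ℝ) ^ (d - 1) / (r : ℝ) ^ (2 * m) ≤ 1 := by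
  have hN0 : (0 : ℝ) < N := by exact_mod_cast hN
  have hterm : ∀ r ∈ Finset.Ico 1 N, (r : ℝ) ^ (d - 1) / (r : ℝ) ^ (2 * m) ≤
      (N : ℝ) ^ (d - 1 - 2 * m) := by
    intro r hr
    obtain ⟨h1, h2⟩ := Finset.mem_Ico.1 hr
    have hr0 : (r : ℝ) ≠ 0 := by
      have : r ≠ 0 := by omega
      exact_mod_cast this
    have e : (r : ℝ) ^ (d - 1) = (r : ℝ) ^ (d - 1 - 2 * m) * (r : ℝ) ^ (2 * m) := by
      rw [← pow_add]; congr 1; omega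
    rw [e, mul_div_cancel_right₀ _ (pow_ne_zero _ hr0)]
    gcongr
  calc _ ≤ (N : ℝ) ^ (2 * m) / (N : ℝ) ^ d *
        ∑ r ∈ Finset.range N, (N : ℝ) ^ (d - 1 - 2 * m) := by
        refine mul_le_mul_of_nonneg_left ((Finset.sum_le_sum hterm).trans ?_) (by positivity)
        refine Finset.sum_le_sum_of_subset_of_nonneg (fun r hr => ?_) fun _ _ _ => by positivity
        exact Finset.mem_range.2 (Finset.mem_Ico.1 hr).2
    _ = (N : ℝ) ^ (2 * m) / (N : ℝ) ^ d * (N : ℝ) ^ (d - 1 - 2 * m + 1) := by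
        rw [Finset.sum_const, Finset.card_range, nsmul_eq_mul, pow_succ']
    _ = 1 := by
        rw [div_mul_eq_mul_div, ← pow_add, show 2 * m + (d - 1 - 2 * m + 1) = d by omega,
          div_self (by positivity)]

lemma sum_pow_div_pow_le_of_eq {m : ℕ} (h : 2 * m = d) (hd : 1 ≤ d) (hN : 1 ≤ N) :
    (N : ℝ) ^ (2 * m) / (N : ℝ) ^ d *
      ∑ r ∈ Finset.Ico 1 N, (r : ℝ) ^ (d - 1) / (r : ℝ) ^ (2 * m) ≤ 1 + Real.log N := by
  have hN0 : (0 : ℝ) < N := by exact_mod_cast hN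
  rw [h, div_self (by positivity), one_mul]
  refine le_trans ?_ (harmonic_le_one_add_log N)
  rw [harmonic_eq_sum_Icc]
  push_cast
  calc _ = ∑ r ∈ Finset.Ico 1 N, (r : ℝ)⁻¹ := by
        refine Finset.sum_congr rfl fun r hr => ?_
        have hr0 : (r : ℝ) ≠ 0 := by
          have : r ≠ 0 := by have := (Finset.mem_Ico.1 hr).1; omega
          exact_mod_cast this
        obtain ⟨e, rfl⟩ : ∃ e, d = e + 1 := ⟨d - 1, by omega⟩
        rw [Nat.add_sub_cancel, pow_succ]
        field_simp
    _ ≤ _ := Finset.sum_le_sum_of_subset_of_nonneg Finset.Ico_subset_Icc_self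
        fun _ _ _ => by positivity

/-- The summand is r^{-(p+1)} ≤ R^{-(p-1)} r^{-2}, and the tail of ∑ r^{-2} from R is at most 2/R.
-/
lemma sum_pow_div_pow_le_of_gt {m p R : ℕ} (h : 2 * m = d + p) (hp : 1 ≤ p) (hd : 1 ≤ d)
    (hN : 1 ≤ N) (hR : 1 ≤ R) :
    (N : ℝ) ^ (2 * m) / (N : ℝ) ^ d *
      ∑ r ∈ Finset.Ico R N, (r : ℝ) ^ (d - 1) / (r : ℝ) ^ (2 * m) ≤ 2 * ((N : ℝ) / R) ^ p := by
  have hN0 : (0 : ℝ) < N := by exact_mod_cast hN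
  have hR0 : (0 : ℝ) < R := by exact_mod_cast hR
  have hterm : ∀ r ∈ Finset.Ico R N, (r : ℝ) ^ (d - 1) / (r : ℝ) ^ (2 * m) ≤
      ((R : ℝ) ^ (p - 1))⁻¹ * ((r : ℝ) ^ 2)⁻¹ := by
    intro r hr
    have hRr : (R : ℝ) ≤ r := by exact_mod_cast (Finset.mem_Ico.1 hr).1
    have hr0 : (0 : ℝ) < r := hR0.trans_le hRr
    have e : (r : ℝ) ^ (2 * m) = (r : ℝ) ^ (d - 1) * ((r : ℝ) ^ (p - 1) * (r : ℝ) ^ 2) := by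
      rw [← pow_add, ← pow_add]; congr 1; omega
    rw [e, div_mul_cancel_left₀ (by positivity), mul_inv]
    gcongr
  have hsq : ∑ r ∈ Finset.Ico R N, ((r : ℝ) ^ 2)⁻¹ ≤ 2 / R := by
    have h1 := sum_Ioo_inv_sq_le (α := ℝ) (R - 1) N
    have e : Finset.Ioo (R - 1) N = Finset.Ico R N := by
      ext r; simp only [Finset.mem_Ioo, Finset.mem_Ico]; omega
    have e' : (((R - 1 : ℕ) : ℝ) + 1) = R := by
      rw [Nat.cast_sub hR]; simp
    rwa [e, e'] at h1
  calc _ ≤ (N : ℝ) ^ (2 * m) / (N : ℝ) ^ d * (((R : ℝ) ^ (p - 1))⁻¹ * (2 / R)) := by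
        refine mul_le_mul_of_nonneg_left ?_ (by positivity)
        refine (Finset.sum_le_sum hterm).trans ?_
        rw [← Finset.mul_sum]
        gcongr
    _ = _ := by
        obtain ⟨e, rfl⟩ : ∃ e, p = e + 1 := ⟨p - 1, by omega⟩
        rw [h, pow_add _ d, Nat.add_sub_cancel, div_pow, pow_succ (R : ℝ)]
        field_simp

end LatticeSums

/-! ### Choice of the cutoff and balance of the rates. -/

section Rates

/-- The defining balance of the rate in the case `s > 1/2`. -/
lemma lamRate_balance {s n C : ℝ} (hs : 1 / 2 < s) (hn : 0 < n) (hC : 0 < C)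
    (hL : 0 < Real.log n) :
    0 < lamRate s n C ∧
      (n / (lamRate s n C * C)) ^ (2 * s - 1) * Real.log n = lamRate s n C ^ 2 := by
  have hrate : lamRate s n C =
      Real.log n ^ (1 / (2 * s + 1)) * (n / C) ^ ((2 * s - 1) / (2 * s + 1)) := by
    rw [lamRate, if_neg hs.not_gt, if_neg hs.ne']
  have hnC : 0 < n / C := div_pos hn hC
  have hpos : 0 < lamRate s n C := by rw [hrate]; positivity
  refine ⟨hpos, ?_⟩
  set ρ := lamRate s n C
  have hpow : ρ ^ (2 * s + 1) = Real.log n * (n / C) ^ (2 * s - 1) := by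
    rw [hrate, Real.mul_rpow (by positivity) (by positivity), ← Real.rpow_mul hL.le,
      ← Real.rpow_mul hnC.le, div_mul_cancel₀ _ (by linarith), div_mul_cancel₀ _ (by linarith),
      Real.rpow_one]
  have hdiv : n / (ρ * C) = (n / C) / ρ := by field_simp
  rw [hdiv, Real.div_rpow hnC.le hpos.le, div_mul_eq_mul_div, mul_comm, ← hpow,
    ← Real.rpow_sub hpos, ← Real.rpow_natCast]
  congr 1
  push_cast
  ring

/-- For every admissible tuning parameter there is a frequency cutoff for which the low frequency
noise and the high frequency noise are both controlled. -/
lemma exists_cutoff {d k : ℕ} (hd : 1 ≤ d) {σ : ℝ} (hσ : 0 < σ) :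
    ∃ A : ℝ, 0 < A ∧ ∀ N : ℕ, 3 ≤ N → ∀ C l : ℝ, 0 ≤ C → (1 / 2 < smoothness d k → 0 < C) →
      A * lamRate (smoothness d k) ((N : ℝ) ^ d) C ≤ l →
      ∃ (R : ℕ) (W : ℝ), 1 ≤ R ∧ 0 < W ∧ 0 ≤ l ∧
        (2 / N : ℝ) ^ d * ∑ i ∈ (lowFrequencies d N R)ᶜ, (gridEigenvalue i ^ (k + 1))⁻¹ ≤ W ∧
        4 * σ ^ 2 * W * Real.log ((N : ℝ) ^ d) ≤ l ^ 2 ∧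
        (R : ℝ) ^ d ≤ 2 ^ d * (1 + l * C / A) := by
  set c : ℝ := 4 ^ d * d with hc
  have hd0 : (0 : ℝ) < d := by exact_mod_cast hd
  have hc0 : 0 < c := by positivity
  -- The 8 is the 4 of the required noise bound times the 2 lost in W when s ≥ 1/2.
  set A : ℝ := √(8 * c * σ ^ 2) with hA
  have hA0 : 0 < A := Real.sqrt_pos.2 (by positivity)
  have hA2 : A ^ 2 = 8 * c * σ ^ 2 := Real.sq_sqrt (by positivity)
  refine ⟨A, hA0, fun N hN C l hC hCpos hl => ?_⟩
  have hN1 : 1 ≤ N := by omega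
  have hN3 : (3 : ℝ) ≤ N := by exact_mod_cast hN
  have hN0 : (0 : ℝ) < N := by linarith
  -- Since e < 3 ≤ N; this later absorbs 1 + log N into 2L.
  have hlogN : 1 ≤ Real.log N := by
    rw [Real.le_log_iff_exp_le hN0]
    linarith [Real.exp_one_lt_d9]
  have hlog : Real.log ((N : ℝ) ^ d) = d * Real.log N := Real.log_pow _ _
  have hd1 : (1 : ℝ) ≤ d := by exact_mod_cast hd
  have hlogle : Real.log N ≤ Real.log ((N : ℝ) ^ d) := by rw [hlog]; nlinarith
  set L := Real.log ((N : ℝ) ^ d) with hL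
  have hL1 : 1 ≤ L := hlogN.trans hlogle
  have hbound := sum_inv_gridEigenvalue_pow_le (d := d) hN1 (le_refl 1) (k + 1)
  have hone : 0 ≤ l → ((1 : ℕ) : ℝ) ^ d ≤ 2 ^ d * (1 + l * C / A) := fun h0 => by
    have h1 : (1 : ℝ) ≤ 2 ^ d := one_le_pow₀ (by norm_num)
    have h2 : 0 ≤ l * C / A := by positivity
    rw [Nat.cast_one, one_pow]
    nlinarith
  rcases lt_trichotomy (smoothness d k) (1 / 2) with hs | hs | hs
  · have hkd : 2 * (k + 1) < d := by
      rw [smoothness, div_lt_div_iff₀ hd0 two_pos] at hs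
      exact_mod_cast (by linarith : (2 : ℝ) * (k + 1) < d)
    rw [lamRate, if_pos hs] at hl
    have hl0 : 0 ≤ l := le_trans (by positivity) hl
    refine ⟨1, c, le_rfl, hc0, hl0, hbound.trans ?_, ?_, hone hl0⟩
    · exact mul_le_of_le_one_right hc0.le (sum_pow_div_pow_le_of_lt hkd hN1)
    · calc 4 * σ ^ 2 * c * L ≤ A ^ 2 * L := by
            rw [hA2]
            have : 0 ≤ c * σ ^ 2 * L := by positivity
            nlinarith
        _ = (A * √L) ^ 2 := by rw [mul_pow, Real.sq_sqrt (by linarith : 0 ≤ L)]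
        _ ≤ l ^ 2 := by gcongr
  · have hkd : 2 * (k + 1) = d := by
      rw [smoothness, div_eq_div_iff hd0.ne' two_ne_zero] at hs
      exact_mod_cast (by linarith : (2 : ℝ) * (k + 1) = d)
    rw [lamRate, if_neg hs.not_lt, if_pos hs] at hl
    have hl0 : 0 ≤ l := le_trans (by positivity) hl
    refine ⟨1, c * (2 * L), le_rfl, by positivity, hl0, hbound.trans ?_, ?_, hone hl0⟩
    · exact mul_le_mul_of_nonneg_left
        ((sum_pow_div_pow_le_of_eq hkd hd hN1).trans (by linarith : _ ≤ 2 * L)) hc0.le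
    · calc 4 * σ ^ 2 * (c * (2 * L)) * L = (A * L) ^ 2 := by rw [mul_pow, hA2]; ring
        _ ≤ l ^ 2 := by gcongr
  · have hC0 := hCpos hs
    obtain ⟨p, hp1, hp⟩ : ∃ p, 1 ≤ p ∧ 2 * (k + 1) = d + p := by
      have : d < 2 * (k + 1) := by
        rw [smoothness, div_lt_div_iff₀ two_pos hd0] at hs
        exact_mod_cast (by linarith : (d : ℝ) < 2 * (k + 1))
      exact ⟨2 * (k + 1) - d, by omega, by omega⟩
    have hps : (d : ℝ) * (2 * smoothness d k - 1) = p := by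
      have : (2 : ℝ) * (k + 1) = d + p := by exact_mod_cast hp
      rw [smoothness]
      field_simp
      linarith
    obtain ⟨hρ, hbal⟩ := lamRate_balance (n := (N : ℝ) ^ d) hs (by positivity) hC0 (by linarith)
    set ρ := lamRate (smoothness d k) ((N : ℝ) ^ d) C
    have hl0 : 0 ≤ l := le_trans (by positivity) hl
    set K := ρ * C with hK
    have hK0 : 0 < K := mul_pos hρ hC0
    have hKd : 0 < K ^ (1 / d : ℝ) := Real.rpow_pos_of_pos hK0 _
    have hKpow : (K ^ (1 / d : ℝ)) ^ d = K := by
      rw [← Real.rpow_natCast, ← Real.rpow_mul hK0.le, one_div_mul_cancel hd0.ne', Real.rpow_one]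
    -- The least integer with R^d ≥ K = ρC: then N/R is small enough for `hbal`, while R^d stays of
    -- order 1 + K.
    set R := ⌈K ^ (1 / d : ℝ)⌉₊ with hR
    have hR1 : 1 ≤ R := Nat.one_le_ceil_iff.2 hKd
    have hR0 : (0 : ℝ) < R := by exact_mod_cast hR1
    have hKR : K ≤ (R : ℝ) ^ d := by
      rw [← hKpow]
      exact pow_le_pow_left₀ hKd.le (Nat.le_ceil _) _
    have hsum : (N / R : ℝ) ^ p ≤ ((N : ℝ) ^ d / K) ^ (2 * smoothness d k - 1) := by
      have e : (N / R : ℝ) ^ p = ((N : ℝ) ^ d / (R : ℝ) ^ d) ^ (2 * smoothness d k - 1) := by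
        rw [← div_pow, ← Real.rpow_natCast _ d, ← Real.rpow_mul (by positivity), hps,
          Real.rpow_natCast]
      rw [e]
      refine Real.rpow_le_rpow (by positivity) ?_ (by linarith)
      gcongr
    refine ⟨R, c * (2 * ((N : ℝ) ^ d / K) ^ (2 * smoothness d k - 1)), hR1, by positivity, hl0,
      (sum_inv_gridEigenvalue_pow_le (d := d) hN1 hR1 (k + 1)).trans ?_, ?_, ?_⟩
    · exact mul_le_mul_of_nonneg_left
        ((sum_pow_div_pow_le_of_gt hp hp1 hd hN1 hR1).trans (by gcongr)) hc0.le
    · calc _ = A ^ 2 * (((N : ℝ) ^ d / K) ^ (2 * smoothness d k - 1) * L) := by rw [hA2]; ring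
        _ = (A * ρ) ^ 2 := by rw [hbal, mul_pow]
        _ ≤ l ^ 2 := by gcongr
    · have hKl : K ≤ l * C / A := by
        rw [le_div_iff₀ hA0]
        calc K * A = A * ρ * C := by rw [hK]; ring
          _ ≤ l * C := by gcongr
      have hRle : (R : ℝ) ≤ 2 * max 1 (K ^ (1 / d : ℝ)) := by
        have := (Nat.ceil_lt_add_one hKd.le).le
        have h1 := le_max_left 1 (K ^ (1 / d : ℝ))
        have h2 := le_max_right 1 (K ^ (1 / d : ℝ))
        linarith
      calc (R : ℝ) ^ d ≤ (2 * max 1 (K ^ (1 / d : ℝ))) ^ d := by gcongr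
        _ = 2 ^ d * max 1 (K ^ (1 / d : ℝ)) ^ d := mul_pow _ _ _
        _ ≤ 2 ^ d * (1 + K) := by
          gcongr
          rcases max_choice 1 (K ^ (1 / d : ℝ)) with h | h <;> rw [h]
          · rw [one_pow]; linarith
          · rw [hKpow]; linarith
        _ ≤ _ := by gcongr

lemma l1Norm_nonneg {ι : Type*} [Fintype ι] (x : ι → ℝ) : 0 ≤ l1Norm x :=
  Finset.sum_nonneg fun _ _ => abs_nonneg _

lemma gtfPenalty_nonneg (d N m : ℕ) (θ : Grid d N → ℝ) : 0 ≤ gtfPenalty d N m θ := by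
  unfold gtfPenalty
  split_ifs <;> exact l1Norm_nonneg _

end Rates

end GridGTF

end

/-! ### Assembly of the probability bound. -/

theorem theorem6 (d k : ℕ) (hd : 1 ≤ d) (σ : ℝ) (hσ : 0 < σ) :
    ∃ A : ℝ, 0 < A ∧
      ∀ (Ω : ℕ → Type*) [∀ N, MeasurableSpace (Ω N)]
        (P : ∀ N, Measure (Ω N)) [∀ N, IsProbabilityMeasure (P N)]
        (θ₀ : ∀ N, GridGTF.Grid d N → ℝ)
        (y θhat : ∀ N, Ω N → GridGTF.Grid d N → ℝ)
        (lam : ℕ → ℝ) (C : ℕ → ℝ) (B : ℝ),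
        (∀ N i, HasLaw (fun ω => y N ω i)
          (gaussianReal (θ₀ N i) ⟨σ ^ 2, sq_nonneg σ⟩) (P N)) →
        (∀ N, iIndepFun (fun i ω => y N ω i) (P N)) →
        (∀ N, C N = GridGTF.gtfPenalty d N (k + 1) (θ₀ N)) →
        (1 / 2 < GridGTF.smoothness d k → ∀ᶠ N in atTop, 0 < C N) →
        (∀ᶠ N : ℕ in atTop,
          A * GridGTF.lamRate (GridGTF.smoothness d k) ((N : ℝ) ^ d) (C N) ≤ lam N ∧
          lam N ≤ B * GridGTF.lamRate (GridGTF.smoothness d k) ((N : ℝ) ^ d) (C N)) →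
        (∀ᶠ N : ℕ in atTop, ∀ ω, GridGTF.IsGTF d N k (lam N) (y N ω) (θhat N ω)) →
        GridGTF.IsBigOInProb P (fun N ω => GridGTF.mse (θhat N ω) (θ₀ N))
          (fun N => 1 / (N : ℝ) ^ d + lam N / (N : ℝ) ^ d * C N) := by
  obtain ⟨A, hA, hcut⟩ := GridGTF.exists_cutoff (k := k) hd hσ
  refine ⟨A, hA, ?_⟩
  intro Ω _ P _ θ₀ y θhat lam C B hlaw hind hC hCpos hlam hgtf δ hδ
  refine ⟨8 * σ ^ 2 * 2 ^ d * (1 + 1 / A) / δ + 8, ?_⟩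
  have hCpos' : ∀ᶠ N in atTop, 1 / 2 < GridGTF.smoothness d k → 0 < C N := by
    by_cases h : 1 / 2 < GridGTF.smoothness d k
    · filter_upwards [hCpos h] with N hN _ using hN
    · exact Eventually.of_forall fun N h' => absurd h' h
  have hlarge : ∀ᶠ N : ℕ in atTop, 4 * d / δ ≤ (N : ℝ) :=
    tendsto_natCast_atTop_atTop.eventually_ge_atTop _
  filter_upwards [hCpos', hlam, hgtf, hlarge, eventually_ge_atTop 3] with N hCN hlN hgN hNδ hN3
  have hC0 : 0 ≤ C N := by rw [hC]; exact GridGTF.gtfPenalty_nonneg _ _ _ _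
  obtain ⟨R, W, hR, hW, hl0, hsum, hlW, hRd⟩ := hcut N hN3 (C N) (lam N) hC0 hCN hlN.1
  have hN0 : (0 : ℝ) < N := by exact_mod_cast (by omega : 0 < N)
  have hN1 : (1 : ℝ) ≤ N := by exact_mod_cast (by omega : 1 ≤ N)
  have hn0 : (0 : ℝ) < (N : ℝ) ^ d := by positivity
  have hNn : (N : ℝ) ≤ (N : ℝ) ^ d := le_self_pow₀ hN1 (by omega)
  have hR0 : (0 : ℝ) < (R : ℝ) ^ d := by
    have : (0 : ℝ) < R := by exact_mod_cast hR
    positivity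
  -- Chosen so that Markov's bound on the low-frequency energy is at most δ/2.
  set t : ℝ := 2 * σ ^ 2 * (R : ℝ) ^ d / δ with ht
  have ht0 : 0 < t := by positivity
  have hmain := GridGTF.measure_gtf_error_gt_le hd (GridGTF.lowFrequencies d N R)
    (fun i hi => GridGTF.gridEigenvalue_ne_zero hR hi) hsum hl0 ht0 (hlaw N) (hind N) hgN
  rw [← hC] at hmain
  refine (measure_mono fun ω hω => ?_).trans (hmain.trans (ENNReal.ofReal_le_ofReal ?_))
  · simp only [Set.mem_ofPred_eq] at hω ⊢
    have hb : 0 ≤ 1 / (N : ℝ) ^ d + lam N / (N : ℝ) ^ d * C N := by positivity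
    have hS : 0 ≤ ∑ i, (θhat N ω i - θ₀ N i) ^ 2 := Finset.sum_nonneg fun _ _ => sq_nonneg _
    rw [GridGTF.mse, abs_of_nonneg hb, abs_of_nonneg (by positivity)] at hω
    have hω' : (8 * σ ^ 2 * 2 ^ d * (1 + 1 / A) / δ + 8) * (1 + lam N * C N) <
        ∑ i, (θhat N ω i - θ₀ N i) ^ 2 := by
      have e : (8 * σ ^ 2 * 2 ^ d * (1 + 1 / A) / δ + 8) *
          (1 / (N : ℝ) ^ d + lam N / (N : ℝ) ^ d * C N) =
          1 / (N : ℝ) ^ d *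
            ((8 * σ ^ 2 * 2 ^ d * (1 + 1 / A) / δ + 8) * (1 + lam N * C N)) := by ring
      rw [e] at hω
      exact lt_of_mul_lt_mul_left hω (by positivity)
    refine lt_of_le_of_lt ?_ hω'
    have hx : 0 ≤ lam N * C N := by positivity
    have h1 : 1 + lam N * C N / A ≤ (1 + 1 / A) * (1 + lam N * C N) := by
      have : (1 + 1 / A) * (1 + lam N * C N) =
          1 + lam N * C N / A + (1 / A + lam N * C N) := by ring
      rw [this]
      have : 0 ≤ 1 / A := by positivity
      linarith
    calc 4 * t + 8 * (lam N * C N) = 8 * σ ^ 2 / δ * (R : ℝ) ^ d + 8 * (lam N * C N) := by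
          rw [ht]; ring
      _ ≤ 8 * σ ^ 2 / δ * (2 ^ d * ((1 + 1 / A) * (1 + lam N * C N))) +
          8 * (1 + lam N * C N) := by
          gcongr
          · exact hRd.trans (by gcongr)
          · linarith
      _ = _ := by ring
  -- By the factor 4 in `hlW` each tail is at most 2n⁻², so the union over at most dn rows costs
  -- 2d/n ≤ δ/2.
  · have hexp : Real.exp (-lam N ^ 2 / (2 * (σ ^ 2 * W))) ≤ ((N : ℝ) ^ d)⁻¹ ^ 2 := by
      have e : ((N : ℝ) ^ d)⁻¹ ^ 2 = Real.exp (-(2 * Real.log ((N : ℝ) ^ d))) := by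
        rw [Real.exp_neg, two_mul, Real.exp_add, Real.exp_log hn0, inv_pow, sq]
      rw [e, Real.exp_le_exp, neg_div, neg_le_neg_iff, le_div_iff₀ (by positivity)]
      linarith
    have hcard : ((GridGTF.lowFrequencies d N R).card : ℝ) ≤ (R : ℝ) ^ d := by
      rw [GridGTF.card_lowFrequencies]
      push_cast
      gcongr
      exact min_le_right _ _
    have h1 : d * (N : ℝ) ^ d * (2 * Real.exp (-lam N ^ 2 / (2 * (σ ^ 2 * W)))) ≤ δ / 2 := by
      calc _ ≤ d * (N : ℝ) ^ d * (2 * ((N : ℝ) ^ d)⁻¹ ^ 2) := by gcongr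
        _ = 2 * d / (N : ℝ) ^ d := by field_simp
        _ ≤ 2 * d / N := by gcongr
        _ ≤ δ / 2 := by
          rw [div_le_iff₀ hδ] at hNδ
          rw [div_le_iff₀ hN0]
          linarith
    have h2 : σ ^ 2 * ((GridGTF.lowFrequencies d N R).card : ℝ) / t ≤ δ / 2 := by
      calc _ ≤ σ ^ 2 * (R : ℝ) ^ d / t := by gcongr
        _ = δ / 2 := by rw [ht]; field_simp
    exact (add_le_add h1 h2).trans_eq (by ring)
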